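/- Let $\mathcal H$ be an infinite-dimensional complex Hilbert space, let $q\ge 1$ and $p_0\ge 1$ be integers, and let $\mathbf A=(A_1,\dots,A_m)$ be an $m$-tuple of bounded self-adjoint operators on $\mathcal H$. For a Hilbert space $\mathcal G$, a tuple $\mathbf T=(T_1,\dots,T_m)$ of bounded operators on $\mathcal G$ and an integer $p\ge 1$, let $\Lambda_{p,q}(\mathbf T)$ be the set of all $m$-tuples $(B_1,\dots,B_m)$ of complex $q\times q$ matrices for which there are a $pq$-dimensional subspace $\mathcal K\subseteq\mathcal G$ and an operator $X:\mathcal K\to\mathcal G$ with $X^*X=I_{\mathcal K}$ such that, in one common orthonormal basis of $\mathcal K$, $X^*T_jX$ has the matrix $I_p\otimes B_j$ for all $j=1,\dots,m$. Let $\Lambda_{\infty,q}(\mathbf A)$ be the set of all $m$-tuples $(B_1,\dots,B_m)$ of complex $q\times q$ matrices for which there are an infinite-dimensional closed subspace $\mathcal K\subseteq\mathcal H$ and an operator $X:\mathcal K\to\mathcal H$ with $X^*X=I_{\mathcal K}$ such that, in one common orthonormal basis of $\mathcal K$, $X^*A_jX$ has the matrix $I_\infty\otimes B_j=B_j\oplus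 B_j\oplus B_j\oplus\cdots$ for all $j$. Let $S_{p,q}(\mathbf A)$ be the set of star-centers of $\Lambda_{p,q}(\mathbf A)$, that is, of those $\mathbf C\in\Lambda_{p,q}(\mathbf A)$ such that $t\mathbf C+(1-t)\mathbf B\in\Lambda_{p,q}(\mathbf A)$ for all $\mathbf B\in\Lambda_{p,q}(\mathbf A)$ and $0\le t\le 1$. Let $\mathcal V^\perp$ be the set of all operators $Y:\mathcal L^\perp\to\mathcal H$ with $Y^*Y=I_{\mathcal L^\perp}$, where $\mathcal L$ is a subspace of $\mathcal H$ of finite dimension $r\ge 1$, that extend to a unitary operator on $\mathcal H$ (equivalently, whose range also has codimension $r$). Let $\mathcal S_{\mathcal F}(\mathcal H)$ be the set of self-adjoint finite-rank operators on $\mathcal H$. Write $Y^*\mathbf AY=(Y^*A_1Y,\dots,Y^*A_mY)$, a tuple of operators on $\mathcal L^\perp$, and $\mathbf A+\mathbf F=(A_1+F_1,\dots,A_m+F_m)$. Then $$\Lambda_{\infty,q}(\mathbf A)=\bigcap_{p\ge 1}S_{p,q}(\mathbf A)=\bigcap_{p\ge 1}\Lambda_{p,q}(\mathbf A)=\bigcap\{\Lambda_{p_0,q}(Y^*\mathbf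 AY):Y\in\mathcal V^\perp\}=\bigcap\{\Lambda_{p_0,q}(\mathbf A+\mathbf F):\mathbf F\in\mathcal S_{\mathcal F}(\mathcal H)^m\}.$$ Consequently, $\Lambda_{\infty,q}(\mathbf A)$ is convex. -/

import Mathlib

open scoped Kronecker

noncomputable section

namespace MatricialRange

variable {H : Type*} [NormedAddCommGroup H] [InnerProductSpace ℂ H] [CompleteSpace H]

/-- `X* A X`, for operators `X : K → H` and `A : H → H`. -/
def compression {K : Type*} [NormedAddCommGroup K] [InnerProductSpace ℂ K] [CompleteSpace K]
    (X : K →L[ℂ] H) (A : H →L[ℂ] H) : K →L[ℂ] K :=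
  (ContinuousLinearMap.adjoint X) ∘L A ∘L X

/-- `X* X` is the identity of `K`. -/
def IsIsometric {K : Type*} [NormedAddCommGroup K] [InnerProductSpace ℂ K] [CompleteSpace K]
    (X : K →L[ℂ] H) : Prop :=
  (ContinuousLinearMap.adjoint X) ∘L X = ContinuousLinearMap.id ℂ K

/-- The tuples `(B_1, …, B_m)` of `q × q` matrices such that, for one isometric `X : K → H`
defined on a closed subspace `K` of `H` and one orthonormal (Hilbert) basis of `K` indexed by
`ι × Fin q`, the matrix of `X* A_j X` in this basis is `I_ι ⊗ B_j` for all `j`.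
If `ι` is finite, the basis is an ordinary orthonormal basis and `dim K = |ι| q`. -/
def rangeOver (ι : Type*) [DecidableEq ι] {m : ℕ} (q : ℕ) (A : Fin m → H →L[ℂ] H) :
    Set (Fin m → Matrix (Fin q) (Fin q) ℂ) :=
  {B | ∃ (K : Submodule ℂ H) (_ : CompleteSpace K) (X : K →L[ℂ] H)
      (b : HilbertBasis (ι × Fin q) ℂ K), IsIsometric X ∧
      ∀ j : Fin m, ∀ s t : ι × Fin q,
        inner ℂ (b s) (compression X (A j) (b t)) = ((1 : Matrix ι ι ℂ) ⊗ₖ B j) s t}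

/-- The joint `(p,q)`-matricial range `Λ_{p,q}(A)`, for `p, q ≥ 1`. -/
def Lam {m : ℕ} (p q : ℕ) (A : Fin m → H →L[ℂ] H) : Set (Fin m → Matrix (Fin q) (Fin q) ℂ) :=
  rangeOver (Fin p) q A

/-- The joint `(∞,q)`-matricial range `Λ_{∞,q}(A)`, for `q ≥ 1`:
here `I_∞ ⊗ B_j = B_j ⊕ B_j ⊕ ⋯`. -/
def LamInfty {m : ℕ} (q : ℕ) (A : Fin m → H →L[ℂ] H) :
    Set (Fin m → Matrix (Fin q) (Fin q) ℂ) :=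
  rangeOver ℕ q A

/-- The set of star-centers of `S`; a star-center is by definition an element of `S`. -/
def starCenters {V : Type*} [AddCommGroup V] [Module ℝ V] (S : Set V) : Set V :=
  {s₀ | s₀ ∈ S ∧ ∀ s ∈ S, ∀ t : ℝ, 0 ≤ t → t ≤ 1 → t • s₀ + (1 - t) • s ∈ S}

/-- `Y : Lᗮ → H` belongs to `𝒱^⊥`: the subspace `L` has finite dimension `r ≥ 1`, `Y* Y` is the
identity of `Lᗮ`, and `Y` is the restriction of a unitary operator on `H` (that is, the range
of `Y` has codimension `r` as well; this is automatic only when `H` is finite-dimensional). -/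
def IsFiniteCodimIsometry (L : Submodule ℂ H) (Y : Lᗮ →L[ℂ] H) : Prop :=
  FiniteDimensional ℂ L ∧ 1 ≤ Module.finrank ℂ L ∧ IsIsometric Y ∧
    ∃ U ∈ unitary (H →L[ℂ] H), ∀ x : Lᗮ, U (x : H) = Y x

/-- `F` is self-adjoint and of finite rank. -/
def IsFiniteRankSelfAdjoint (F : H →L[ℂ] H) : Prop :=
  IsSelfAdjoint F ∧ FiniteDimensional ℂ (LinearMap.range (F : H →ₗ[ℂ] H))

end MatricialRange

end

/-!
Both `Λ_{∞,q}(A)` and all the intersections consist of the tuples `B` that have a block (an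
orthonormal `q`-tuple of vectors in which `A` has the matrices `B`) orthogonal to any prescribed
finite-dimensional subspace. If `B` has such blocks, they can be chosen successively so that each
one is orthogonal to its predecessors and to their images under the `A j` and their adjoints;
together they realize `I_∞ ⊗ B`. Combining them with a realization of another tuple, with
coefficients `√t` and `√(1 - t)`, gives star-centrality and hence convexity.

Conversely, let `M` be a finite-dimensional subspace. A realization of `I_p ⊗ B` contains a block
orthogonal to `M` as soon as `p > q dim M`, by a dimension count, and a realization in the
compression of `A` to `Mᗮ` gives one directly. For the finite-rank perturbations, Radon's theorem
provides an orthonormal `q`-tuple `y` in `Mᗮ` in which every `A j` has a scalar matrix `c j • 1`.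
Let `N` be the span of `M`, `y` and their images under the `A j` and their adjoints, and perturb
`A j` to the operator that is `c j` on `N` and the compression of `A j` on `Nᗮ`. In a block of the
perturbed tuple, the components in `N` can be replaced by combinations of `y`, which yields a block
of `A` orthogonal to `M`.
-/

namespace MatricialRange

open Submodule

theorem exists_norm_eq_one_of_ne_bot {E : Type*} [NormedAddCommGroup E] [NormedSpace ℂ E]
    {S : Submodule ℂ E} (hS : S ≠ ⊥) : ∃ v ∈ S, ‖v‖ = 1 := by
  obtain ⟨v, hv, hv₀⟩ := S.ne_bot_iff.1 hS
  exact ⟨(‖v‖ : ℂ)⁻¹ • v, S.smul_mem _ hv, norm_smul_inv_norm hv₀⟩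

theorem exists_mem_orthogonal_norm_eq_one {E : Type*} [NormedAddCommGroup E]
    [InnerProductSpace ℂ E] (hE : ¬ FiniteDimensional ℂ E) (M : Submodule ℂ E)
    [FiniteDimensional ℂ M] : ∃ y ∈ Mᗮ, ‖y‖ = 1 := by
  refine exists_norm_eq_one_of_ne_bot fun h => hE ?_
  rw [orthogonal_eq_bot_iff] at h
  exact Module.Finite.equiv (LinearEquiv.ofTop M h)

theorem exists_stdSimplex_of_mem_convexHull_image {ι E : Type*} [Fintype ι] [AddCommGroup E]
    [Module ℝ E] {f : ι → E} {I : Set ι} {c : E} (hc : c ∈ convexHull ℝ (f '' I)) :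
    ∃ w ∈ stdSimplex ℝ ι, (∀ i ∉ I, w i = 0) ∧ ∑ i, w i • f i = c := by
  classical
  let S : Submodule ℝ (ι → ℝ) := Submodule.pi Iᶜ fun _ => ⊥
  suffices h : convexHull ℝ (f '' I) ⊆
      Fintype.linearCombination ℝ f '' (stdSimplex ℝ ι ∩ S) by
    obtain ⟨w, ⟨hw, hwI⟩, hwc⟩ := h hc
    exact ⟨w, hw, fun i hi => by simpa using hwI i hi, hwc⟩
  refine convexHull_min ?_ (((convex_stdSimplex ℝ ι).inter S.convex).linear_image _)
  rintro _ ⟨i, hi, rfl⟩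
  refine ⟨Pi.single i 1, ⟨single_mem_stdSimplex ℝ i, fun k hk => ?_⟩, ?_⟩
  · exact Pi.single_eq_of_ne (M := fun _ => ℝ) (fun h => hk (by rwa [h])) _
  · simp [Fintype.linearCombination_apply_single]

theorem exists_radon_weights {ι E : Type*} [Fintype ι] [AddCommGroup E] [Module ℝ E]
    [FiniteDimensional ℝ E] (hι : Module.finrank ℝ E + 1 < Fintype.card ι) (f : ι → E) :
    ∃ (w : Bool → ι → ℝ) (c : E), (∀ b, w b ∈ stdSimplex ℝ ι) ∧
      (∀ b b' i, b ≠ b' → w b i * w b' i = 0) ∧ ∀ b, ∑ i, w b i • f i = c := by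
  have hf : ¬ AffineIndependent ℝ f := fun h => by
    have h₁ := h.card_le_finrank_succ
    have h₂ := Submodule.finrank_le (vectorSpan ℝ (Set.range f))
    omega
  obtain ⟨I, c, hc, hc'⟩ := Convex.radon_partition hf
  obtain ⟨w, hw, hwI, hwc⟩ := exists_stdSimplex_of_mem_convexHull_image hc
  obtain ⟨w', hw', hwI', hwc'⟩ := exists_stdSimplex_of_mem_convexHull_image hc'
  have hdisj : ∀ i, w i * w' i = 0 := fun i => by
    by_cases hi : i ∈ I
    · rw [hwI' i (by simpa using hi), mul_zero]
    · rw [hwI i hi, zero_mul]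
  refine ⟨fun b => cond b w w', c, ?_, ?_, ?_⟩
  · exact Bool.forall_bool.2 ⟨hw', hw⟩
  · rintro (_ | _) (_ | _) i h
    exacts [absurd rfl h, (mul_comm _ _).trans (hdisj i), hdisj i, absurd rfl h]
  · exact Bool.forall_bool.2 ⟨hwc', hwc⟩

/- The columns of `W` are the square roots of the weights of a Radon partition of the points
`d i`, viewed in the real vector space `J → ℂ`. -/
theorem exists_conjTranspose_mul_diagonal_mul_eq_smul_one {ι J : Type*} [Fintype ι]
    [DecidableEq ι] [Fintype J] (hι : 2 * Fintype.card J + 1 < Fintype.card ι)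
    (d : J → ι → ℂ) :
    ∃ (W : Matrix ι Bool ℂ) (c : J → ℂ), W.conjTranspose * W = 1 ∧
      ∀ j, W.conjTranspose * Matrix.diagonal (d j) * W = c j • (1 : Matrix Bool Bool ℂ) := by
  obtain ⟨w, c, hw, hdisj, hc⟩ := exists_radon_weights (E := J → ℂ) (by
    simpa [Module.finrank_pi_fintype, mul_comm] using hι) (fun i j => d j i)
  let W : Matrix ι Bool ℂ := Matrix.of fun i b => ((√(w b i) : ℝ) : ℂ)
  have hmul : ∀ b b' i, star (W i b) * W i b' = if b = b' then (w b i : ℂ) else 0 := by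
    intro b b' i
    rw [show star (W i b) * W i b' = ((√(w b i * w b' i) : ℝ) : ℂ) by
      simp [W, Real.sqrt_mul ((hw b).1 i)]]
    split_ifs with h
    · rw [← h, Real.sqrt_mul_self ((hw b).1 i)]
    · rw [hdisj b b' i h, Real.sqrt_zero, Complex.ofReal_zero]
  have hdiag : ∀ e : ι → ℂ, W.conjTranspose * Matrix.diagonal e * W =
      Matrix.diagonal fun b => ∑ i, (w b i : ℂ) * e i := fun e => by
    ext b b'
    rw [Matrix.mul_apply]
    simp only [Matrix.mul_diagonal, Matrix.conjTranspose_apply, mul_right_comm _ (e _), hmul,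
      Matrix.diagonal_apply]
    split_ifs <;> simp only [zero_mul, Finset.sum_const_zero]
  refine ⟨W, c, ?_, fun j => ?_⟩
  · have := hdiag fun _ => 1
    rw [Matrix.diagonal_one, Matrix.mul_one] at this
    rw [this, ← Matrix.diagonal_one]
    congr 1
    ext b
    simpa using congrArg ((↑) : ℝ → ℂ) (hw b).2
  · rw [hdiag, ← Matrix.diagonal_one, ← Matrix.diagonal_smul]
    congr 1
    ext b
    simpa using congrFun (hc b) j

section Families

variable {H : Type*} [NormedAddCommGroup H] [InnerProductSpace ℂ H]
  {ι κ κ' J : Type*}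

/-- The matrix `(⟪x s, T (x t)⟫)` of the sesquilinear form of `T` along the family `x`; for
`T = 1` it is the Gram matrix of `x`. -/
noncomputable def formMatrix (T : H →L[ℂ] H) (x : κ → H) : Matrix κ κ ℂ :=
  Matrix.of fun s t => inner ℂ (x s) (T (x t))

/-- The family `x V`, where `x` is regarded as a row of vectors. -/
noncomputable def mix [Fintype κ] (x : κ → H) (V : Matrix κ κ' ℂ) (t : κ') : H :=
  ∑ s, V s t • x s

/-- The tuple `A` has the matrices `C` in the orthonormal family `x`. -/
def Realizes (A : J → H →L[ℂ] H) (C : J → Matrix κ κ ℂ) (x : κ → H) : Prop :=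
  Orthonormal ℂ x ∧ ∀ j, formMatrix (A j) x = C j

/-- The vectors `v` and `w` are orthogonal, also after applying an operator of the tuple `A` to
one of them. Families that are mutually decoupled give block diagonal compressions of `A`. -/
def Decoupled (A : J → H →L[ℂ] H) (v w : H) : Prop :=
  inner ℂ v w = 0 ∧ ∀ j, inner ℂ v (A j w) = 0 ∧ inner ℂ w (A j v) = 0

theorem Decoupled.symm {A : J → H →L[ℂ] H} {v w : H} (h : Decoupled A v w) : Decoupled A w v :=
  ⟨inner_eq_zero_symm.1 h.1, fun j => (h.2 j).symm⟩

theorem orthonormal_iff_formMatrix_one [DecidableEq κ] {x : κ → H} :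
    Orthonormal ℂ x ↔ formMatrix 1 x = 1 :=
  Matrix.gram_eq_one_iff_orthonormal.symm

theorem formMatrix_smul (T : H →L[ℂ] H) (a : ℂ) (x : κ → H) :
    formMatrix T (a • x) = (star a * a) • formMatrix T x := by
  ext s t
  simp [formMatrix]
  ring

theorem formMatrix_add {T : H →L[ℂ] H} {x y : κ → H}
    (hxy : ∀ s t, inner ℂ (x s) (T (y t)) = 0) (hyx : ∀ s t, inner ℂ (y s) (T (x t)) = 0) :
    formMatrix T (x + y) = formMatrix T x + formMatrix T y := by
  ext s t
  simp [formMatrix, hxy, hyx]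

theorem formMatrix_one_add_of_decoupled {A : J → H →L[ℂ] H} {x y : κ → H}
    (h : ∀ s t, Decoupled A (x s) (y t)) :
    formMatrix 1 (x + y) = formMatrix 1 x + formMatrix 1 y :=
  formMatrix_add (fun s t => (h s t).1) fun s t => (h t s).symm.1

theorem formMatrix_add_of_decoupled {A : J → H →L[ℂ] H} {x y : κ → H}
    (h : ∀ s t, Decoupled A (x s) (y t)) (j : J) :
    formMatrix (A j) (x + y) = formMatrix (A j) x + formMatrix (A j) y :=
  formMatrix_add (fun s t => ((h s t).2 j).1) fun s t => ((h t s).2 j).2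

theorem formMatrix_mix [Fintype κ] (T : H →L[ℂ] H) (x : κ → H) (V : Matrix κ κ' ℂ) :
    formMatrix T (mix x V) = V.conjTranspose * formMatrix T x * V := by
  ext s t
  simp only [formMatrix, mix, map_sum, map_smul, sum_inner, inner_sum, inner_smul_left,
    inner_smul_right, Matrix.of_apply, Matrix.mul_apply, Matrix.conjTranspose_apply,
    Finset.sum_mul, Finset.mul_sum]
  exact Finset.sum_congr rfl fun _ _ => Finset.sum_congr rfl fun _ _ => by
    rw [starRingEnd_apply]; ring

theorem mix_mem [Fintype κ] {S : Submodule ℂ H} {x : κ → H} (hx : ∀ s, x s ∈ S)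
    (V : Matrix κ κ' ℂ) (t : κ') : mix x V t ∈ S :=
  S.sum_mem fun s _ => S.smul_mem _ (hx s)

theorem Realizes.comp {A : J → H →L[ℂ] H} {C : J → Matrix κ κ ℂ} {x : κ → H}
    (hx : Realizes A C x) {e : κ' → κ} (he : Function.Injective e) :
    Realizes A (fun j => (C j).submatrix e e) (x ∘ e) :=
  ⟨hx.1.comp e he, fun j => congrArg (Matrix.submatrix · e e) (hx.2 j)⟩

theorem Realizes.block [DecidableEq ι] {A : J → H →L[ℂ] H} {C : J → Matrix κ κ ℂ}
    {x : ι × κ → H} (hx : Realizes A (fun j => (1 : Matrix ι ι ℂ) ⊗ₖ C j) x) (i : ι) :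
    Realizes A C (x ∘ Prod.mk i) := by
  convert hx.comp (Prod.mk_right_injective i) using 1
  ext j s t
  simp

theorem Realizes.mix_kronecker_one {ι' : Type*} [Fintype ι] [DecidableEq ι'] [Fintype κ]
    [DecidableEq κ] {A : J → H →L[ℂ] H} {D : J → Matrix ι ι ℂ} {C : J → Matrix κ κ ℂ}
    {x : ι × κ → H} (hx : Realizes A (fun j => D j ⊗ₖ C j) x) {W : Matrix ι ι' ℂ}
    (hW : W.conjTranspose * W = 1) :
    Realizes A (fun j => (W.conjTranspose * D j * W) ⊗ₖ C j)
      (mix x (W ⊗ₖ (1 : Matrix κ κ ℂ))) := by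
  classical
  refine ⟨orthonormal_iff_formMatrix_one.2 ?_, fun j => ?_⟩
  · rw [formMatrix_mix, orthonormal_iff_formMatrix_one.1 hx.1, Matrix.mul_one,
      Matrix.conjTranspose_kronecker, ← Matrix.mul_kronecker_mul, hW, Matrix.conjTranspose_one,
      Matrix.mul_one, Matrix.one_kronecker_one]
  · rw [formMatrix_mix, hx.2, Matrix.conjTranspose_kronecker, ← Matrix.mul_kronecker_mul,
      ← Matrix.mul_kronecker_mul, Matrix.conjTranspose_one, Matrix.mul_one, Matrix.one_mul]

theorem Decoupled.smul {A : J → H →L[ℂ] H} {v w : H} (h : Decoupled A v w) (a b : ℂ) :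
    Decoupled A (a • v) (b • w) := by
  simp [Decoupled, h.1, (h.2 _).1, (h.2 _).2]

theorem Realizes.convexCombination {A : J → H →L[ℂ] H} {C D : J → Matrix κ κ ℂ} {x y : κ → H}
    (hx : Realizes A C x) (hy : Realizes A D y) (hxy : ∀ s t, Decoupled A (x s) (y t))
    {a b : ℝ} (ha : 0 ≤ a) (hb : 0 ≤ b) (hab : a + b = 1) :
    Realizes A (fun j => a • C j + b • D j) (((√a : ℝ) : ℂ) • x + ((√b : ℝ) : ℂ) • y) := by
  classical
  have hsqrt : ∀ {r : ℝ}, 0 ≤ r → star ((√r : ℝ) : ℂ) * ((√r : ℝ) : ℂ) = (r : ℂ) := fun hr => by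
    rw [Complex.star_def, Complex.conj_ofReal, ← Complex.ofReal_mul, Real.mul_self_sqrt hr]
  have hdec : ∀ s t, Decoupled A ((((√a : ℝ) : ℂ) • x) s) ((((√b : ℝ) : ℂ) • y) t) :=
    fun s t => (hxy s t).smul _ _
  refine ⟨orthonormal_iff_formMatrix_one.2 ?_, fun j => ?_⟩
  · rw [formMatrix_one_add_of_decoupled hdec, formMatrix_smul, formMatrix_smul, hsqrt ha, hsqrt hb,
      orthonormal_iff_formMatrix_one.1 hx.1, orthonormal_iff_formMatrix_one.1 hy.1, ← add_smul,
      ← Complex.ofReal_add, hab, Complex.ofReal_one, one_smul]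
  · rw [formMatrix_add_of_decoupled hdec, formMatrix_smul, formMatrix_smul, hsqrt ha, hsqrt hb,
      hx.2, hy.2, Complex.coe_smul, Complex.coe_smul]

theorem realizes_diagonal_kronecker [DecidableEq ι] {A : J → H →L[ℂ] H} {d : J → ι → ℂ}
    {C : J → Matrix κ κ ℂ} {x : ι → κ → H}
    (hx : ∀ i, Realizes A (fun j => d j i • C j) (x i))
    (hdec : ∀ i i', i ≠ i' → ∀ s t, Decoupled A (x i s) (x i' t)) :
    Realizes A (fun j => Matrix.diagonal (d j) ⊗ₖ C j) (fun p : ι × κ => x p.1 p.2) := by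
  classical
  refine ⟨orthonormal_iff_ite.2 ?_, fun j => ?_⟩
  · rintro ⟨i, s⟩ ⟨i', t⟩
    obtain rfl | hi := eq_or_ne i i'
    · simpa using orthonormal_iff_ite.1 (hx i).1 s t
    · simp [(hdec i i' hi s t).1, hi]
  · ext ⟨i, s⟩ ⟨i', t⟩
    obtain rfl | hi := eq_or_ne i i'
    · simpa [formMatrix] using congrFun₂ ((hx i).2 j) s t
    · simp [formMatrix, ((hdec i i' hi s t).2 j).1, hi]

theorem Realizes.exists_block_mem_orthogonal [Fintype ι] [DecidableEq ι] [Fintype κ]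
    {A : J → H →L[ℂ] H} {C : J → Matrix κ κ ℂ} {x : ι × κ → H}
    (hx : Realizes A (fun j => (1 : Matrix ι ι ℂ) ⊗ₖ C j) x) (M : Submodule ℂ H)
    [FiniteDimensional ℂ M] (hM : Fintype.card κ * Module.finrank ℂ M < Fintype.card ι) :
    ∃ y : κ → H, (∀ s, y s ∈ Mᗮ) ∧ Realizes A C y := by
  classical
  let T : EuclideanSpace ℂ ι →ₗ[ℂ] κ → M := LinearMap.pi fun s =>
    M.orthogonalProjectionOnto.toLinearMap ∘ₗ
      Fintype.linearCombination ℂ (fun i => x (i, s)) ∘ₗ (WithLp.linearEquiv 2 ℂ (ι → ℂ))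
  obtain ⟨v, hv, hv₁⟩ := exists_norm_eq_one_of_ne_bot
    (LinearMap.ker_ne_bot_of_finrank_lt (f := T) (by simpa [Module.finrank_pi_fintype] using hM))
  let W : Matrix ι Unit ℂ := Matrix.of fun i _ => v i
  have hW : W.conjTranspose * W = 1 := by
    ext ⟨⟩ ⟨⟩
    have hinner : inner ℂ v v = 1 := by simp [inner_self_eq_norm_sq_to_K, hv₁]
    rw [PiLp.inner_apply] at hinner
    exact (Finset.sum_congr rfl fun i _ => mul_comm _ _).trans hinner
  have hWx : ∀ s, mix x (W ⊗ₖ (1 : Matrix κ κ ℂ)) ((), s) = ∑ i, v i • x (i, s) := fun s => by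
    simp [mix, W, Fintype.sum_prod_type, Matrix.one_apply]
  refine ⟨mix x (W ⊗ₖ (1 : Matrix κ κ ℂ)) ∘ Prod.mk (), fun s => ?_, ?_⟩
  · rw [Function.comp_apply, hWx, ← orthogonalProjectionOnto_eq_zero_iff]
    exact congrFun (LinearMap.mem_ker.1 hv) s
  · exact Realizes.block (by simpa only [Matrix.mul_one, hW] using hx.mix_kronecker_one hW) ()

end Families

section Operators

open ContinuousLinearMap (adjoint)

variable {H : Type*} [NormedAddCommGroup H] [InnerProductSpace ℂ H] [CompleteSpace H]
  {ι κ J : Type*}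

/-- The sum of `M` and its images under the operators of `A` and their adjoints. It is only used
through its orthogonal complement, whose vectors are decoupled from those of `M`. -/
noncomputable def enlarge (A : J → H →L[ℂ] H) (M : Submodule ℂ H) : Submodule ℂ H :=
  M ⊔ ⨆ j, (M.map (A j).toLinearMap ⊔ M.map (adjoint (A j)).toLinearMap)

instance [Finite J] (A : J → H →L[ℂ] H) (M : Submodule ℂ H) [FiniteDimensional ℂ M] :
    FiniteDimensional ℂ (enlarge A M) := by
  unfold enlarge
  infer_instance

theorem le_enlarge (A : J → H →L[ℂ] H) (M : Submodule ℂ H) : M ≤ enlarge A M :=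
  le_sup_left

theorem decoupled_of_mem_orthogonal_enlarge {A : J → H →L[ℂ] H} {M : Submodule ℂ H} {v w : H}
    (hv : v ∈ M) (hw : w ∈ (enlarge A M)ᗮ) : Decoupled A v w := by
  have himage : ∀ j, M.map (A j).toLinearMap ⊔ M.map (adjoint (A j)).toLinearMap ≤ enlarge A M :=
    fun j => le_sup_of_le_right (le_iSup_of_le j le_rfl)
  refine ⟨inner_right_of_mem_orthogonal (le_enlarge A M hv) hw, fun j => ⟨?_, ?_⟩⟩
  · rw [← ContinuousLinearMap.adjoint_inner_left]
    exact inner_right_of_mem_orthogonal (himage j (mem_sup_right (mem_map_of_mem hv))) hw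
  · exact inner_left_of_mem_orthogonal (himage j (mem_sup_left (mem_map_of_mem hv))) hw

theorem exists_decoupled_seq [Finite J] [Finite κ] (A : J → H →L[ℂ] H) {P : (κ → H) → Prop}
    (hP : ∀ M : Submodule ℂ H, FiniteDimensional ℂ M → ∃ x, (∀ s, x s ∈ Mᗮ) ∧ P x)
    (M : Submodule ℂ H) [FiniteDimensional ℂ M] :
    ∃ x : ℕ → κ → H, (∀ i, (∀ s, x i s ∈ Mᗮ) ∧ P (x i)) ∧
      ∀ i i', i ≠ i' → ∀ s t, Decoupled A (x i s) (x i' t) := by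
  have : Std.Symm fun x y : κ → H => ∀ s t, Decoupled A (x s) (y t) :=
    ⟨fun _ _ h s t => (h t s).symm⟩
  obtain ⟨x, hx, hdec⟩ := exists_seq_of_forall_finset_exists'
    (fun x : κ → H => (∀ s, x s ∈ Mᗮ) ∧ P x) (fun x y => ∀ s t, Decoupled A (x s) (y t))
    fun F _ => by
      have : ∀ x : κ → H, FiniteDimensional ℂ (span ℂ (Set.range x)) := fun x =>
        .span_of_finite ℂ (Set.finite_range x)
      let N : Submodule ℂ H := F.sup fun x => span ℂ (Set.range x)
      obtain ⟨y, hy, hPy⟩ := hP (M ⊔ enlarge A N) inferInstance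
      refine ⟨y, ⟨fun s => orthogonal_le le_sup_left (hy s), hPy⟩, fun x hx s t => ?_⟩
      exact decoupled_of_mem_orthogonal_enlarge
        (Finset.le_sup (f := fun x => span ℂ (Set.range x)) hx
          (subset_span (Set.mem_range_self s)))
        (orthogonal_le le_sup_right (hy t))
  exact ⟨x, hx, fun i i' h => hdec h⟩

/-- Orthogonally to every finite-dimensional subspace, `A` has the matrices `C` in some orthonormal
family. For finite `κ` this is an intrinsic form of membership in `Λ_{∞,q}(A)`. -/
def EssentiallyRealizable (A : J → H →L[ℂ] H) (C : J → Matrix κ κ ℂ) : Prop :=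
  ∀ M : Submodule ℂ H, FiniteDimensional ℂ M → ∃ x : κ → H, (∀ s, x s ∈ Mᗮ) ∧ Realizes A C x

theorem EssentiallyRealizable.exists_kronecker [Finite J] [Finite κ] [Countable ι] [DecidableEq ι]
    {A : J → H →L[ℂ] H} {C : J → Matrix κ κ ℂ} (h : EssentiallyRealizable A C)
    (M : Submodule ℂ H) [FiniteDimensional ℂ M] :
    ∃ x : ι × κ → H, (∀ p, x p ∈ Mᗮ) ∧ Realizes A (fun j => (1 : Matrix ι ι ℂ) ⊗ₖ C j) x := by
  obtain ⟨x, hx, hdec⟩ := exists_decoupled_seq A h M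
  obtain ⟨e, he⟩ := Countable.exists_injective_nat ι
  refine ⟨fun p => (x ∘ e) p.1 p.2, fun p => (hx _).1 _, ?_⟩
  simpa only [Matrix.diagonal_one] using realizes_diagonal_kronecker (d := fun _ _ => 1)
    (x := x ∘ e) (fun i => by simpa only [one_smul] using! (hx (e i)).2)
    fun i i' hi => hdec _ _ (he.ne hi)

end Operators

section Ranges

variable {H : Type*} [NormedAddCommGroup H] [InnerProductSpace ℂ H] [CompleteSpace H]
  {ι ι' κ J : Type*}

theorem IsIsometric.inner_map_map {K : Type*} [NormedAddCommGroup K] [InnerProductSpace ℂ K]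
    [CompleteSpace K] {X : K →L[ℂ] H} (hX : IsIsometric X) (v w : K) :
    inner ℂ (X v) (X w) = inner ℂ v w := by
  rw [← ContinuousLinearMap.adjoint_inner_right]
  exact congrArg (inner ℂ v) (congrArg (fun T : K →L[ℂ] K => T w) hX)

theorem isIsometric_subtypeL (K : Submodule ℂ H) [CompleteSpace K] : IsIsometric K.subtypeL := by
  refine ContinuousLinearMap.ext fun v => ext_inner_left ℂ fun w => ?_
  rw [ContinuousLinearMap.comp_apply, ContinuousLinearMap.adjoint_inner_right]
  rfl

theorem realizes_compression_iff {K : Type*} [NormedAddCommGroup K] [InnerProductSpace ℂ K]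
    [CompleteSpace K] {X : K →L[ℂ] H} (hX : IsIsometric X) {A : J → H →L[ℂ] H}
    {C : J → Matrix κ κ ℂ} {x : κ → K} :
    Realizes (fun j => compression X (A j)) C x ↔ Realizes A C (X ∘ x) := by
  classical
  have hform : ∀ j, formMatrix (compression X (A j)) x = formMatrix (A j) (X ∘ x) := fun j => by
    ext s t
    simp only [formMatrix, compression, Matrix.of_apply, ContinuousLinearMap.comp_apply,
      ContinuousLinearMap.adjoint_inner_right, Function.comp_apply]
  simp only [Realizes, hform, orthonormal_iff_ite, Function.comp_apply, hX.inner_map_map]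

theorem exists_hilbertBasis_coe_eq {x : ι → H} (hx : Orthonormal ℂ x) :
    ∃ (K : Submodule ℂ H) (_ : CompleteSpace K) (b : HilbertBasis ι ℂ K), ∀ i, (b i : H) = x i := by
  classical
  let V := hx.orthogonalFamily.linearIsometry
  let b : HilbertBasis ι ℂ V.toLinearMap.range := .ofRepr V.equivRange.symm
  have : CompleteSpace V.toLinearMap.range :=
    V.isometry.isClosedEmbedding.isClosed_range.completeSpace_coe
  refine ⟨V.toLinearMap.range, this, b, fun i => ?_⟩
  rw [← b.repr_symm_single]
  exact (hx.orthogonalFamily.linearIsometry_apply_single (1 : ℂ)).trans (by simp)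

theorem mem_rangeOver_iff [DecidableEq ι] {m q : ℕ} {A : Fin m → H →L[ℂ] H}
    {B : Fin m → Matrix (Fin q) (Fin q) ℂ} :
    B ∈ rangeOver ι q A ↔
      ∃ x : ι × Fin q → H, Realizes A (fun j => (1 : Matrix ι ι ℂ) ⊗ₖ B j) x := by
  constructor
  · rintro ⟨K, _, X, b, hX, hb⟩
    exact ⟨X ∘ b, (realizes_compression_iff hX).1 ⟨b.orthonormal, fun j => Matrix.ext (hb j)⟩⟩
  · rintro ⟨x, hx⟩
    obtain ⟨K, _, b, hb⟩ := exists_hilbertBasis_coe_eq hx.1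
    obtain rfl : K.subtypeL ∘ b = x := funext hb
    exact ⟨K, _, K.subtypeL, b, isIsometric_subtypeL K, fun j =>
      congrFun₂ (((realizes_compression_iff (isIsometric_subtypeL K)).2 hx).2 j)⟩

theorem rangeOver_subset_of_embedding [DecidableEq ι] [DecidableEq ι'] (e : ι' ↪ ι) {m q : ℕ}
    (A : Fin m → H →L[ℂ] H) : rangeOver ι q A ⊆ rangeOver ι' q A := fun B hB => by
  obtain ⟨x, hx⟩ := mem_rangeOver_iff.1 hB
  refine mem_rangeOver_iff.2 ⟨x ∘ Prod.map e id, ?_⟩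
  convert hx.comp (e.injective.prodMap Function.injective_id) using 1
  ext j s t
  simp [Matrix.one_apply]

theorem LamInfty_subset_Lam {m : ℕ} (p q : ℕ) (A : Fin m → H →L[ℂ] H) :
    LamInfty q A ⊆ Lam p q A :=
  rangeOver_subset_of_embedding Fin.valEmbedding A

theorem exists_block_of_mem_Lam {m p q : ℕ} {A : Fin m → H →L[ℂ] H}
    {B : Fin m → Matrix (Fin q) (Fin q) ℂ} (hB : B ∈ Lam p q A) (M : Submodule ℂ H)
    [FiniteDimensional ℂ M] (hp : q * Module.finrank ℂ M < p) :
    ∃ x : Fin q → H, (∀ s, x s ∈ Mᗮ) ∧ Realizes A B x := by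
  obtain ⟨x, hx⟩ := mem_rangeOver_iff.1 hB
  exact hx.exists_block_mem_orthogonal M (by simpa only [Fintype.card_fin] using hp)

theorem mem_LamInfty_iff {m q : ℕ} {A : Fin m → H →L[ℂ] H} {B : Fin m → Matrix (Fin q) (Fin q) ℂ} :
    B ∈ LamInfty q A ↔ EssentiallyRealizable A B := by
  refine ⟨fun h M _ => exists_block_of_mem_Lam (LamInfty_subset_Lam _ q A h) M
    (Nat.lt_succ_self _), fun h => ?_⟩
  obtain ⟨x, -, hx⟩ := h.exists_kronecker (ι := ℕ) ⊥
  exact mem_rangeOver_iff.2 ⟨x, hx⟩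

theorem LamInfty_eq_iInter_Lam {m : ℕ} (q : ℕ) (A : Fin m → H →L[ℂ] H) :
    LamInfty q A = ⋂ (p : ℕ) (_ : 1 ≤ p), Lam p q A := by
  refine (Set.subset_iInter₂ fun p _ => LamInfty_subset_Lam p q A).antisymm fun B hB => ?_
  exact mem_LamInfty_iff.2 fun M _ => exists_block_of_mem_Lam
    (Set.mem_iInter₂.1 hB _ (Nat.succ_pos _)) M (Nat.lt_succ_self _)

theorem LamInfty_subset_starCenters_Lam {m : ℕ} (p q : ℕ) (A : Fin m → H →L[ℂ] H) :
    LamInfty q A ⊆ starCenters (Lam p q A) := fun C hC => by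
  refine ⟨LamInfty_subset_Lam p q A hC, fun B hB t ht₀ ht₁ => ?_⟩
  obtain ⟨x, hx⟩ := mem_rangeOver_iff.1 hB
  have : FiniteDimensional ℂ (span ℂ (Set.range x)) := .span_of_finite ℂ (Set.finite_range x)
  obtain ⟨y, hy, hyC⟩ := (mem_LamInfty_iff.1 hC).exists_kronecker (ι := Fin p)
    (enlarge A (span ℂ (Set.range x)))
  have hdec : ∀ s r, Decoupled A (y s) (x r) := fun s r =>
    (decoupled_of_mem_orthogonal_enlarge (subset_span (Set.mem_range_self r)) (hy s)).symm
  have hz := hyC.convexCombination hx hdec ht₀ (sub_nonneg.2 ht₁) (add_sub_cancel _ _)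
  simp only [← Matrix.kronecker_smul, ← Matrix.kronecker_add] at hz
  exact mem_rangeOver_iff.2 ⟨_, hz⟩

theorem LamInfty_eq_iInter_starCenters_Lam {m : ℕ} (q : ℕ) (A : Fin m → H →L[ℂ] H) :
    LamInfty q A = ⋂ (p : ℕ) (_ : 1 ≤ p), starCenters (Lam p q A) := by
  refine (Set.subset_iInter₂ fun p _ => LamInfty_subset_starCenters_Lam p q A).antisymm ?_
  rw [LamInfty_eq_iInter_Lam]
  exact Set.iInter₂_mono fun p _ _ h => h.1

theorem convex_LamInfty {m : ℕ} (q : ℕ) (A : Fin m → H →L[ℂ] H) : Convex ℝ (LamInfty q A) := by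
  intro C hC B hB a b ha hb hab
  rw [LamInfty_eq_iInter_Lam]
  refine Set.mem_iInter₂.2 fun p _ => ?_
  obtain rfl : b = 1 - a := eq_sub_of_add_eq' hab
  exact (LamInfty_subset_starCenters_Lam p q A hC).2 B (LamInfty_subset_Lam p q A hB) a ha
    (sub_nonneg.1 hb)

end Ranges

section Intersections

variable {H : Type*} [NormedAddCommGroup H] [InnerProductSpace ℂ H] [CompleteSpace H] {m : ℕ}

theorem exists_realizes_of_mem_Lam {p q : ℕ} (hp : 1 ≤ p) {A : Fin m → H →L[ℂ] H}
    {B : Fin m → Matrix (Fin q) (Fin q) ℂ} (hB : B ∈ Lam p q A) : ∃ x, Realizes A B x := by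
  obtain ⟨x, hx⟩ := mem_rangeOver_iff.1 hB
  exact ⟨_, hx.block ⟨0, hp⟩⟩

theorem LamInfty_subset_Lam_compression (p q : ℕ) (A : Fin m → H →L[ℂ] H) {L : Submodule ℂ H}
    {Y : Lᗮ →L[ℂ] H} (hY : IsFiniteCodimIsometry L Y) :
    LamInfty q A ⊆ Lam p q fun j => compression Y (A j) := fun B hB => by
  obtain ⟨_, -, hYiso, U, hU, hUY⟩ := hY
  obtain ⟨x, hx, hxB⟩ :=
    (mem_LamInfty_iff.1 hB).exists_kronecker (ι := Fin p) (L.map U.toLinearMap)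
  have hpre : ∀ s, star U (x s) ∈ Lᗮ := fun s l hl => by
    rw [ContinuousLinearMap.star_eq_adjoint, ContinuousLinearMap.adjoint_inner_right]
    exact hx s (U l) (mem_map_of_mem hl)
  have hUU : U * star U = 1 := Unitary.mul_star_self_of_mem hU
  have hYx : Y ∘ (fun s => (⟨star U (x s), hpre s⟩ : Lᗮ)) = x := funext fun s => by
    rw [Function.comp_apply, ← hUY, ← mul_apply_eq_comp, hUU, one_apply_eq_self]
  exact mem_rangeOver_iff.2 ⟨_, (realizes_compression_iff hYiso).2 (hYx.symm ▸ hxB)⟩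

theorem LamInfty_eq_iInter_Lam_compression (hH : ¬ FiniteDimensional ℂ H) {p : ℕ} (hp : 1 ≤ p)
    (q : ℕ) (A : Fin m → H →L[ℂ] H) :
    LamInfty q A = ⋂ (L : Submodule ℂ H) (Y : Lᗮ →L[ℂ] H) (_ : IsFiniteCodimIsometry L Y),
      Lam p q fun j => compression Y (A j) := by
  refine Set.Subset.antisymm (Set.subset_iInter fun L => Set.subset_iInter₂ fun Y hY => ?_)
    fun B hB => ?_
  · exact LamInfty_subset_Lam_compression p q A hY
  refine mem_LamInfty_iff.2 fun M _ => ?_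
  obtain ⟨y, -, hy⟩ := exists_mem_orthogonal_norm_eq_one hH M
  let L : Submodule ℂ H := M ⊔ span ℂ {y}
  have hL : L ≠ ⊥ := (L.ne_bot_iff).2
    ⟨y, mem_sup_right (mem_span_singleton_self y), norm_ne_zero_iff.1 (hy ▸ one_ne_zero)⟩
  have hY : IsFiniteCodimIsometry L Lᗮ.subtypeL :=
    ⟨inferInstance, one_le_finrank_iff.2 hL, isIsometric_subtypeL _, 1, one_mem _, fun _ => rfl⟩
  obtain ⟨x, hx⟩ :=
    exists_realizes_of_mem_Lam hp (Set.mem_iInter₂.1 (Set.mem_iInter.1 hB L) Lᗮ.subtypeL hY)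
  exact ⟨_, fun s => orthogonal_le le_sup_left (x s).2,
    (realizes_compression_iff (isIsometric_subtypeL _)).1 hx⟩

theorem LamInfty_subset_Lam_add (p q : ℕ) (A : Fin m → H →L[ℂ] H) {F : Fin m → H →L[ℂ] H}
    (hF : ∀ j, FiniteDimensional ℂ (F j).toLinearMap.range) :
    LamInfty q A ⊆ Lam p q fun j => A j + F j := fun B hB => by
  obtain ⟨x, hx, hxo, hxB⟩ :=
    (mem_LamInfty_iff.1 hB).exists_kronecker (ι := Fin p) (⨆ j, (F j).toLinearMap.range)
  refine mem_rangeOver_iff.2 ⟨x, hxo, fun j => ?_⟩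
  rw [← hxB j]
  ext s t
  have hzero : inner ℂ (x s) (F j (x t)) = 0 :=
    inner_left_of_mem_orthogonal (le_iSup (fun j => (F j).toLinearMap.range) j ⟨x t, rfl⟩) (hx s)
  simp [formMatrix, hzero]

end Intersections

section ScalarBlocks

variable {H : Type*} [NormedAddCommGroup H] [InnerProductSpace ℂ H] {κ κ' J : Type*}

/-- Every finite-dimensional subspace is orthogonal to some orthonormal family indexed by `κ` in
which all operators of `A` have scalar matrices. -/
def HasScalarBlocks (κ : Type*) [DecidableEq κ] (A : J → H →L[ℂ] H) : Prop :=
  ∀ M : Submodule ℂ H, FiniteDimensional ℂ M → ∃ x : κ → H, (∀ s, x s ∈ Mᗮ) ∧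
    ∃ c : J → ℂ, Realizes A (fun j => c j • 1) x

theorem hasScalarBlocks_of_subsingleton (hH : ¬ FiniteDimensional ℂ H) [DecidableEq κ]
    [Subsingleton κ] (A : J → H →L[ℂ] H) : HasScalarBlocks κ A := fun M _ => by
  obtain ⟨y, hyM, hy⟩ := exists_mem_orthogonal_norm_eq_one hH M
  refine ⟨fun _ => y, fun _ => hyM, fun j => inner ℂ y (A j y), ?_, fun j => ?_⟩
  · exact ⟨fun _ => hy, fun s t hst => (hst (Subsingleton.elim s t)).elim⟩
  · ext s t
    simp [formMatrix, Subsingleton.elim s t]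

theorem HasScalarBlocks.of_injective [DecidableEq κ] [DecidableEq κ'] {A : J → H →L[ℂ] H}
    (h : HasScalarBlocks κ A) {e : κ' → κ} (he : Function.Injective e) :
    HasScalarBlocks κ' A := fun M hM => by
  obtain ⟨x, hxM, c, hx⟩ := h M hM
  refine ⟨x ∘ e, fun s => hxM (e s), c, ?_⟩
  simpa [Matrix.submatrix_smul, Matrix.submatrix_one e he] using! hx.comp he

theorem HasScalarBlocks.bool_prod [CompleteSpace H] [Finite κ] [DecidableEq κ] [Finite J]
    {A : J → H →L[ℂ] H} (h : HasScalarBlocks κ A) : HasScalarBlocks (Bool × κ) A := fun M hM => by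
  have := Fintype.ofFinite J
  have := Fintype.ofFinite κ
  obtain ⟨x, hx, hdec⟩ := exists_decoupled_seq A h M
  choose hxM d hxd using hx
  let n := 2 * Fintype.card J + 2
  obtain ⟨W, c, hW, hWd⟩ := exists_conjTranspose_mul_diagonal_mul_eq_smul_one (ι := Fin n)
    (by simp [n]) fun j i => d i j
  have hblocks := realizes_diagonal_kronecker (d := fun j (i : Fin n) => d i j)
    (fun i : Fin n => hxd i) fun i i' hi => hdec i i' (Fin.val_injective.ne hi)
  have hmix := hblocks.mix_kronecker_one hW
  simp only [hWd, Matrix.smul_kronecker, Matrix.one_kronecker_one] at hmix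
  exact ⟨_, mix_mem (fun p : Fin n × κ => hxM p.1 p.2) _, c, hmix⟩

theorem hasScalarBlocks [CompleteSpace H] (hH : ¬ FiniteDimensional ℂ H) (κ : Type*) [Finite κ]
    [DecidableEq κ] [Finite J] (A : J → H →L[ℂ] H) : HasScalarBlocks κ A := by
  have hpow : ∀ n : ℕ, HasScalarBlocks (Fin (2 ^ n)) A := fun n => by
    induction n with
    | zero =>
      have : Subsingleton (Fin (2 ^ 0)) := inferInstanceAs (Subsingleton (Fin 1))
      exact hasScalarBlocks_of_subsingleton hH A
    | succ n ih =>
      have e : Fin (2 ^ (n + 1)) ≃ Bool × Fin (2 ^ n) :=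
        Fintype.equivOfCardEq (by simp [pow_succ, mul_comm])
      exact ih.bool_prod.of_injective e.injective
  obtain ⟨e⟩ : Nonempty (κ ↪ Fin (2 ^ Nat.card κ)) := by
    have := Fintype.ofFinite κ
    exact Function.Embedding.nonempty_of_card_le (by simpa using Nat.lt_two_pow_self.le)
  exact (hpow _).of_injective e.injective

theorem Realizes.re_smul_one [CompleteSpace H] [DecidableEq κ] {A : J → H →L[ℂ] H}
    (hA : ∀ j, IsSelfAdjoint (A j)) {c : J → ℂ} {x : κ → H}
    (hx : Realizes A (fun j => c j • 1) x) :
    Realizes A (fun j => ((c j).re : ℂ) • 1) x := by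
  refine ⟨hx.1, fun j => ?_⟩
  ext s t
  rw [hx.2]
  obtain rfl | hst := eq_or_ne s t
  · have hc : inner ℂ (x s) (A j (x s)) = c j := by
      simpa [formMatrix] using congrFun₂ (hx.2 j) s s
    simpa [hc] using! ((hA j).isSymmetric.coe_re_inner_self_apply (x s)).symm
  · simp [hst]

end ScalarBlocks

section Perturbation

variable {H : Type*} [NormedAddCommGroup H] [InnerProductSpace ℂ H] {κ J : Type*}

/-- The operator `P T P + c Q`, where `P` and `Q` are the orthogonal projections onto `Nᗮ` and
`N`: the compression of `T` to `Nᗮ` is kept, and `N` becomes an eigenspace with eigenvalue `c`. -/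
noncomputable def replaceByScalar (N : Submodule ℂ H) [N.HasOrthogonalProjection] (T : H →L[ℂ] H)
    (c : ℂ) : H →L[ℂ] H :=
  Nᗮ.starProjection * T * Nᗮ.starProjection + c • N.starProjection

theorem replaceByScalar_one_one (N : Submodule ℂ H) [N.HasOrthogonalProjection] :
    replaceByScalar N 1 1 = 1 := by
  rw [replaceByScalar, mul_one, Nᗮ.isIdempotentElem_starProjection.eq, one_smul,
    starProjection_orthogonal']
  exact sub_add_cancel _ _

theorem formMatrix_replaceByScalar (N : Submodule ℂ H) [N.HasOrthogonalProjection]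
    (T : H →L[ℂ] H) (c : ℂ) (x : κ → H) :
    formMatrix (replaceByScalar N T c) x =
      formMatrix T (Nᗮ.starProjection ∘ x) + c • formMatrix 1 (N.starProjection ∘ x) := by
  ext s t
  have hN (v : H) : N.starProjection (N.starProjection v) = N.starProjection v :=
    starProjection_eq_self_iff.2 (N.starProjection_apply_mem v)
  simp only [formMatrix, replaceByScalar, Matrix.of_apply, Matrix.add_apply, Matrix.smul_apply,
    Function.comp_apply, add_apply, smul_apply, mul_apply_eq_comp, one_apply_eq_self,
    inner_add_right, inner_smul_right, inner_starProjection_left_eq_right, hN, smul_eq_mul]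

theorem exists_formMatrix_one_eq_conjTranspose_mul_self [Fintype κ] (x : κ → H) :
    ∃ V : Matrix κ κ ℂ, formMatrix 1 x = V.conjTranspose * V := by
  open scoped MatrixOrder in
  classical
  exact CStarAlgebra.nonneg_iff_eq_star_mul_self.1 (Matrix.posSemidef_gram ℂ x).nonneg

variable [CompleteSpace H]

theorem isFiniteRankSelfAdjoint_replaceByScalar_sub (N : Submodule ℂ H) [FiniteDimensional ℂ N]
    {T : H →L[ℂ] H} (hT : IsSelfAdjoint T) (c : ℝ) :
    IsFiniteRankSelfAdjoint (replaceByScalar N T c - T) := by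
  refine ⟨?_, ?_⟩
  · have hP : IsSelfAdjoint Nᗮ.starProjection := isSelfAdjoint_starProjection _
    have hQ : IsSelfAdjoint N.starProjection := isSelfAdjoint_starProjection _
    exact ((hT.conjugate_self hP).add (.smul (Complex.conj_ofReal c) hQ)).sub hT
  · refine finiteDimensional_of_le (S₂ := N ⊔ N.map (Nᗮ.starProjection * T).toLinearMap) ?_
    rintro _ ⟨v, rfl⟩
    have hsplit : (replaceByScalar N T c - T) v =
        N.starProjection ((c : ℂ) • v - T v) +
          (Nᗮ.starProjection * T) (-N.starProjection v) := by
      simp [replaceByScalar, starProjection_orthogonal_val]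
      abel
    exact hsplit ▸ add_mem_sup (N.starProjection_apply_mem _)
      (mem_map_of_mem (neg_mem (N.starProjection_apply_mem v)))

/- The component of `x` in `N` is replaced by the combination of `y` with the same Gram matrix:
both `A j` on `y` and `replaceByScalar N (A j) (c j)` on `N` act by the scalar `c j`. -/
theorem Realizes.exists_mix_of_replaceByScalar [Finite J] [Fintype κ] [DecidableEq κ]
    {A : J → H →L[ℂ] H} {c : J → ℂ} {L : Submodule ℂ H} [FiniteDimensional ℂ L] {y : κ → H}
    (hyL : ∀ s, y s ∈ L) (hy : Realizes A (fun j => c j • 1) y) {C : J → Matrix κ κ ℂ} {x : κ → H}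
    (hx : Realizes (fun j => replaceByScalar (enlarge A L) (A j) (c j)) C x) :
    ∃ V, Realizes A C (mix y V + (enlarge A L)ᗮ.starProjection ∘ x) := by
  obtain ⟨V, hV⟩ :=
    exists_formMatrix_one_eq_conjTranspose_mul_self ((enlarge A L).starProjection ∘ x)
  have hdec : ∀ s t, Decoupled A (mix y V s) (((enlarge A L)ᗮ.starProjection ∘ x) t) :=
    fun s t => decoupled_of_mem_orthogonal_enlarge (mix_mem hyL V s) (starProjection_apply_mem _ _)
  refine ⟨V, orthonormal_iff_formMatrix_one.2 ?_, fun j => ?_⟩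
  · calc
      _ = formMatrix (replaceByScalar (enlarge A L) 1 1) x := by
        rw [formMatrix_one_add_of_decoupled hdec, formMatrix_mix,
          orthonormal_iff_formMatrix_one.1 hy.1, Matrix.mul_one, ← hV, add_comm,
          formMatrix_replaceByScalar, one_smul]
      _ = 1 := by rw [replaceByScalar_one_one, orthonormal_iff_formMatrix_one.1 hx.1]
  · calc
      _ = formMatrix (replaceByScalar (enlarge A L) (A j) (c j)) x := by
        rw [formMatrix_add_of_decoupled hdec, formMatrix_mix, hy.2, Matrix.mul_smul,
          Matrix.smul_mul, Matrix.mul_one, ← hV, add_comm, formMatrix_replaceByScalar]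
      _ = C j := hx.2 j

theorem exists_perturbation_forall_realizes [Finite J] [Finite κ] (hH : ¬ FiniteDimensional ℂ H)
    {A : J → H →L[ℂ] H} (hA : ∀ j, IsSelfAdjoint (A j)) (M : Submodule ℂ H)
    [FiniteDimensional ℂ M] :
    ∃ F : J → H →L[ℂ] H, (∀ j, IsFiniteRankSelfAdjoint (F j)) ∧
      ∀ (C : J → Matrix κ κ ℂ) (x : κ → H), Realizes (fun j => A j + F j) C x →
        ∃ z : κ → H, (∀ s, z s ∈ Mᗮ) ∧ Realizes A C z := by
  classical
  have := Fintype.ofFinite κ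
  obtain ⟨y, hyM, c, hy⟩ := hasScalarBlocks hH κ A M inferInstance
  have : FiniteDimensional ℂ (span ℂ (Set.range y)) := .span_of_finite ℂ (Set.finite_range y)
  let L : Submodule ℂ H := M ⊔ span ℂ (Set.range y)
  refine ⟨fun j => replaceByScalar (enlarge A L) (A j) (c j).re - A j, fun j =>
    isFiniteRankSelfAdjoint_replaceByScalar_sub _ (hA j) _, fun C x hx => ?_⟩
  simp only [add_sub_cancel] at hx
  obtain ⟨V, hV⟩ := (hy.re_smul_one hA).exists_mix_of_replaceByScalar (L := L)
    (fun s => mem_sup_right (subset_span (Set.mem_range_self s))) hx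
  refine ⟨_, fun s => add_mem (mix_mem hyM V s) ?_, hV⟩
  exact orthogonal_le (le_sup_left.trans (le_enlarge A L)) (starProjection_apply_mem _ _)

theorem LamInfty_eq_iInter_Lam_add (hH : ¬ FiniteDimensional ℂ H) {m p : ℕ} (hp : 1 ≤ p) (q : ℕ)
    {A : Fin m → H →L[ℂ] H} (hA : ∀ j, IsSelfAdjoint (A j)) :
    LamInfty q A = ⋂ (F : Fin m → H →L[ℂ] H) (_ : ∀ j, IsFiniteRankSelfAdjoint (F j)),
      Lam p q fun j => A j + F j := by
  refine Set.Subset.antisymm (Set.subset_iInter₂ fun F hF => ?_) fun B hB => ?_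
  · exact LamInfty_subset_Lam_add p q A fun j => (hF j).2
  refine mem_LamInfty_iff.2 fun M _ => ?_
  obtain ⟨F, hF, hFM⟩ := exists_perturbation_forall_realizes (κ := Fin q) hH hA M
  obtain ⟨x, hx⟩ := exists_realizes_of_mem_Lam hp (Set.mem_iInter₂.1 hB F hF)
  exact hFM B x hx

end Perturbation

end MatricialRange

theorem theorem3p2 {H : Type*} [NormedAddCommGroup H] [InnerProductSpace ℂ H] [CompleteSpace H]
    (hH : ¬ FiniteDimensional ℂ H) {m : ℕ} (q : ℕ) (hq : 1 ≤ q) (p₀ : ℕ) (hp₀ : 1 ≤ p₀)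
    (A : Fin m → H →L[ℂ] H) (hA : ∀ j, IsSelfAdjoint (A j)) :
    (MatricialRange.LamInfty q A =
        (⋂ (p : ℕ) (_ : 1 ≤ p), MatricialRange.starCenters (MatricialRange.Lam p q A))) ∧
    (MatricialRange.LamInfty q A =
        (⋂ (p : ℕ) (_ : 1 ≤ p), MatricialRange.Lam p q A)) ∧
    (MatricialRange.LamInfty q A =
        (⋂ (L : Submodule ℂ H) (Y : Lᗮ →L[ℂ] H) (_ : MatricialRange.IsFiniteCodimIsometry L Y),
          MatricialRange.Lam p₀ q (fun j => MatricialRange.compression Y (A j)))) ∧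
    (MatricialRange.LamInfty q A =
        (⋂ (F : Fin m → H →L[ℂ] H) (_ : ∀ j, MatricialRange.IsFiniteRankSelfAdjoint (F j)),
          MatricialRange.Lam p₀ q (fun j => A j + F j))) ∧
    Convex ℝ (MatricialRange.LamInfty q A) := by
  exact ⟨MatricialRange.LamInfty_eq_iInter_starCenters_Lam q A,
    MatricialRange.LamInfty_eq_iInter_Lam q A,
    MatricialRange.LamInfty_eq_iInter_Lam_compression hH hp₀ q A,
    MatricialRange.LamInfty_eq_iInter_Lam_add hH hp₀ q hA, MatricialRange.convex_LamInfty q A⟩
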